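/- Let $(R,\mathfrak m)$ be a (commutative, Noetherian) local ring of Krull dimension one such that, for some $x\in\mathfrak m$, $(0:_R x)=(0:_R\mathfrak m)$, where $(0:_R I)$ denotes the annihilator of $I$ in $R$. Let $M$ be an $R$-module of finite length, and let $\operatorname{Syz}_{n}M$ denote its $n$-th syzygy, that is, for $n\ge 1$, the image of $G_{n}\to G_{n-1}$ in a minimal free resolution $\cdots\to G_2\to G_1\to G_0\to M\to 0$ of $M$ by finitely generated free modules. Then, for every even integer $i\ge 2$, if $\operatorname{Syz}_{i+1}M\neq 0$, then $\operatorname{Syz}_{i+1}M$ has infinite length. -/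

import Mathlib

universe u v w

/-- A minimal free resolution `⋯ → G 2 → G 1 → G 0 → M → 0` of a module `M` over a local ring `R`:
the modules `G j` are finitely generated and free, the sequence is exact, and the
image of each differential `G (j + 1) → G j` lies in `𝔪 G j`. -/
structure MinimalFreeResolution (R : Type u) [CommRing R] [IsLocalRing R]
    (M : Type v) [AddCommGroup M] [Module R M] where
  /-- the free modules of the resolution -/
  G : ℕ → Type w
  [addCommGroup : ∀ j, AddCommGroup (G j)]
  [module : ∀ j, Module R (G j)]
  [free : ∀ j, Module.Free R (G j)]
  [finite : ∀ j, Module.Finite R (G j)]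
  /-- the differentials -/
  d : ∀ j, G (j + 1) →ₗ[R] G j
  /-- the augmentation -/
  ε : G 0 →ₗ[R] M
  surjective_ε : Function.Surjective ε
  exact_zero : Function.Exact (d 0) ε
  exact_succ : ∀ j, Function.Exact (d (j + 1)) (d j)
  minimal : ∀ j, LinearMap.range (d j) ≤ IsLocalRing.maximalIdeal R • (⊤ : Submodule R (G j))

namespace MinimalFreeResolution

attribute [instance] addCommGroup module free finite

/-- The `(n + 1)`-st syzygy `Syz_{n+1} M` computed from a minimal free resolution of `M`:
the image of `G (n + 1) → G n`, which by exactness is the kernel of `G n → G (n - 1)`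
(of `G 0 → M` if `n = 0`). -/
def syzygySucc {R : Type u} [CommRing R] [IsLocalRing R] {M : Type v} [AddCommGroup M] [Module R M]
    (F : MinimalFreeResolution.{u, v, w} R M) (n : ℕ) : Submodule R (F.G n) :=
  LinearMap.range (F.d n)

end MinimalFreeResolution

/-! Suppose `Syz_{i+1}` is nonzero of finite length, hence `x`-power torsion; then `(0 : x) ≠ 0`.
Torsion descends two steps at a time (`syzygySucc_isTorsion_of_add_two`). If `ker (G (n+2) → G
(n+1))` has finite length, a length count on `x`-torsion gives `rank G (n+1) ≤ rank G (n+2)`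
(`finrank_le_of_length_ker_ne_top`). Over the Artinian ring `R_x` this map becomes injective, so by
rank it is onto, and its cokernel `Syz_{n+1}` is `x`-power torsion (`exists_pow_smul_mem_range`).
For even `i` the descent ends at `Syz_1`; as `M` has finite length, `G 0` is torsion as well. Since
`x` is not nilpotent, `G 0 = 0` and the whole resolution vanishes. -/

open IsLocalRing Submodule

/-! ### Finite length and `x`-torsion in free modules. -/

section Torsion

variable {R : Type*} [CommRing R] [IsLocalRing R] {x : R}

/-- A finitely generated module killed by the maximal ideal has finite length. -/
theorem length_ne_top_of_maximalIdeal_smul_eq_zero [IsNoetherianRing R]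
    {N : Type*} [AddCommGroup N] [Module R N]
    [Module.Finite R N] (h : ∀ r ∈ maximalIdeal R, ∀ n : N, r • n = 0) :
    Module.length R N ≠ ⊤ := by
  have ht : Module.IsTorsionBySet R N (maximalIdeal R : Set R) := fun n r => h r r.2 n
  let : Module (R ⧸ maximalIdeal R) N := ht.module
  have : IsScalarTower R (R ⧸ maximalIdeal R) N := ht.isScalarTower
  let : Field (R ⧸ maximalIdeal R) := Ideal.Quotient.field _
  have : Module.Finite (R ⧸ maximalIdeal R) N := Module.Finite.of_restrictScalars_finite R _ _
  rw [Module.length_eq_of_surjective (S := R) (R := R ⧸ maximalIdeal R)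
    (M := N) Ideal.Quotient.mk_surjective]
  exact Module.length_ne_top

/-- An element of the maximal ideal acts nilpotently on a module of finite length. -/
theorem exists_pow_smul_eq_zero_of_isFiniteLength
    {M : Type*} [AddCommGroup M] [Module R M]
    (hM : IsFiniteLength R M) (hx : x ∈ maximalIdeal R) :
    ∃ n : ℕ, ∀ m : M, x ^ n • m = 0 := by
  obtain ⟨_, _⟩ := isFiniteLength_iff_isNoetherian_isArtinian.mp hM
  obtain ⟨n, hn⟩ := IsArtinian.range_smul_pow_stabilizes (M := M) x
  refine ⟨n, ?_⟩
  have h := hn (n + 1) n.le_succ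
  -- Nakayama: stabilization gives `x ^ n M = x • x ^ n M`.
  have hbot : LinearMap.range (x ^ n • LinearMap.id : M →ₗ[R] M) = ⊥ := by
    refine Submodule.eq_bot_of_le_smul_of_le_jacobson_bot (maximalIdeal R) _
      (IsNoetherian.noetherian _) ?_ (maximalIdeal_le_jacobson _)
    conv_lhs => rw [h]
    rintro _ ⟨m, rfl⟩
    simp only [LinearMap.smul_apply, LinearMap.id_apply, pow_succ', mul_smul]
    exact Submodule.smul_mem_smul hx ⟨m, rfl⟩
  intro m
  have : (x ^ n • LinearMap.id : M →ₗ[R] M) m ∈ (⊥ : Submodule R M) := hbot ▸ ⟨m, rfl⟩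
  simpa using this


/-- On a Noetherian module on which `x` acts locally nilpotently, `x` acts nilpotently. -/
theorem exists_forall_pow_smul_eq_zero {R N : Type*} [CommRing R] [AddCommGroup N] [Module R N]
    [IsNoetherian R N] {x : R} (h : ∀ a : N, ∃ n : ℕ, x ^ n • a = 0) :
    ∃ n : ℕ, ∀ a : N, x ^ n • a = 0 := by
  let T : ℕ →o Submodule R N := ⟨fun n => torsionBy R N (x ^ n), fun n m hnm a ha =>
    torsionBy_le_torsionBy_of_dvd _ _ (pow_dvd_pow x hnm) ha⟩
  obtain ⟨n, hn⟩ := monotone_stabilizes_iff_noetherian.mpr ‹_› T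
  refine ⟨n, fun a => ?_⟩
  obtain ⟨k, hk⟩ := h a
  have : a ∈ T n := by
    rw [hn (max n k) (le_max_left _ _)]
    exact T.monotone (le_max_right n k) hk
  exact this

/-- In a free module, an element killed by `x` lies in `(0 : x) • ⊤`. -/
theorem torsionBy_le_smul_top {R A : Type*} [CommRing R] [AddCommGroup A] [Module R A] [Module.Free R A]
    (x : R) : torsionBy R A x ≤ (⊥ : Ideal R).colon {x} • (⊤ : Submodule R A) := by
  intro a ha
  let b := Module.Free.chooseBasis R A
  rw [← b.linearCombination_repr a, Finsupp.linearCombination_apply]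
  refine Submodule.sum_mem _ fun i _ => Submodule.smul_mem_smul ?_ trivial
  rw [Submodule.mem_colon_singleton, Submodule.mem_bot, smul_eq_mul, mul_comm]
  have : b.repr (x • a) i = 0 := by rw [(mem_torsionBy_iff x a).mp ha]; simp
  simpa using this

/-- The `x`-torsion of a free module has length proportional to the rank. -/
theorem length_torsionBy_of_free {A : Type*} [AddCommGroup A] [Module R A] [Module.Free R A]
    [Module.Finite R A] (x : R) :
    Module.length R (torsionBy R A x) = Module.finrank R A * Module.length R (torsionBy R R x) := by
  let b := Module.Free.chooseBasis R A
  let e : torsionBy R A x ≃ₗ[R] (Module.Free.ChooseBasisIndex R A → torsionBy R R x) :=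
    { toFun := fun a i => ⟨b.repr a i, by
        rw [mem_torsionBy_iff, ← Finsupp.smul_apply, ← map_smul, (mem_torsionBy_iff x _).mp a.2]
        simp⟩
      map_add' := fun a a' => by ext; simp
      map_smul' := fun r a => by ext; simp
      invFun := fun c => ⟨b.equivFun.symm fun i => c i, by
        rw [mem_torsionBy_iff, ← map_smul]
        convert map_zero b.equivFun.symm
        ext i
        exact (mem_torsionBy_iff x _).mp (c i).2⟩
      left_inv := fun a => by
        ext
        exact b.equivFun.symm_apply_apply (a : A)
      right_inv := fun c => by
        ext i
        exact congrFun (b.equivFun.apply_symm_apply fun i => (c i : R)) i }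
  rw [e.length_eq, Module.length_pi, Module.finrank_eq_card_chooseBasisIndex]
  simp


/-- In a free module, an element killed by `x` is killed by the maximal ideal. -/
theorem smul_eq_zero_of_mem_torsionBy
    (hann : (⊥ : Ideal R).colon {x} = (⊥ : Ideal R).colon (maximalIdeal R : Set R))
    {A : Type*} [AddCommGroup A] [Module R A] [Module.Free R A] {a : A}
    (ha : x • a = 0) {r : R} (hr : r ∈ maximalIdeal R) : r • a = 0 := by
  have := torsionBy_le_smul_top x ((mem_torsionBy_iff x a).mpr ha)
  rw [hann] at this
  refine Submodule.smul_induction_on this (fun t ht c _ => ?_) fun c d hc hd => by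
    rw [smul_add, hc, hd, add_zero]
  rw [smul_smul, mul_comm, ← smul_eq_mul, (Submodule.mem_bot R).mp (Submodule.mem_colon.mp ht r hr),
    zero_smul]

/-- A map of free modules with image in `𝔪 B` kills the `x`-torsion. -/
theorem map_eq_zero_of_minimal
    (hann : (⊥ : Ideal R).colon {x} = (⊥ : Ideal R).colon (maximalIdeal R : Set R))
    {A B : Type*} [AddCommGroup A] [Module R A] [Module.Free R A] [AddCommGroup B] [Module R B]
    (f : A →ₗ[R] B) (hf : LinearMap.range f ≤ maximalIdeal R • (⊤ : Submodule R B)) {a : A}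
    (ha : x • a = 0) : f a = 0 := by
  have := torsionBy_le_smul_top x ((mem_torsionBy_iff x a).mpr ha)
  rw [hann] at this
  refine Submodule.smul_induction_on this (fun t ht c _ => ?_) fun c d hc hd => by
    rw [map_add, hc, hd, add_zero]
  rw [map_smul]
  refine Submodule.smul_induction_on (hf ⟨c, rfl⟩) (fun r hr b _ => ?_) fun c d hc hd => by
    rw [smul_add, hc, hd, add_zero]
  rw [smul_smul, ← smul_eq_mul, (Submodule.mem_bot R).mp (Submodule.mem_colon.mp ht r hr),
    zero_smul]

/-- A submodule of a free module on which `x` acts nilpotently has finite length. -/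
theorem length_ne_top_of_pow_smul_eq_zero [IsNoetherianRing R]
    (hann : (⊥ : Ideal R).colon {x} = (⊥ : Ideal R).colon (maximalIdeal R : Set R))
    {A : Type*} [AddCommGroup A] [Module R A] [Module.Free R A] [Module.Finite R A]
    (n : ℕ) (N : Submodule R A) (h : ∀ a ∈ N, x ^ n • a = 0) : Module.length R N ≠ ⊤ := by
  induction n generalizing N with
  | zero =>
    obtain rfl : N = ⊥ := by
      rw [eq_bot_iff]
      intro a ha
      simpa using h a ha
    rw [Module.length_bot]
    exact ENat.zero_ne_top
  | succ n ih =>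
    -- Multiplication by `x`: its image is killed by `x ^ n`, its kernel by `𝔪`.
    let g : N →ₗ[R] A := (LinearMap.lsmul R A x).comp N.subtype
    have hr : Module.length R (LinearMap.range g) ≠ ⊤ := ih _ <| by
      rintro _ ⟨a, rfl⟩
      have := h a a.2
      rwa [pow_succ, mul_smul] at this
    have hk : Module.length R (LinearMap.ker g) ≠ ⊤ :=
      length_ne_top_of_maximalIdeal_smul_eq_zero fun r hr a => by
        ext
        exact smul_eq_zero_of_mem_torsionBy hann (a := ((a : N) : A)) a.2 hr
    rw [Module.length_eq_add_of_exact (LinearMap.ker g).subtype g.rangeRestrict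
      (Submodule.subtype_injective _) g.surjective_rangeRestrict
      (by rw [LinearMap.exact_iff]; simp)]
    exact WithTop.add_ne_top.mpr ⟨hk, hr⟩

/-- If `ker f` has finite length, where `f : A → B` and `g : B → C` are maps with `A`, `B` free,
`ker g = im f` and `im g ⊆ 𝔪 C`, then `rank B ≤ rank A`. -/
theorem finrank_le_of_length_ker_ne_top [IsNoetherianRing R]
    (hann : (⊥ : Ideal R).colon {x} = (⊥ : Ideal R).colon (maximalIdeal R : Set R))
    (hsoc : torsionBy R R x ≠ ⊥)
    {A B C : Type*} [AddCommGroup A] [Module R A] [Module.Free R A] [Module.Finite R A]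
    [AddCommGroup B] [Module R B] [Module.Free R B] [Module.Finite R B]
    [AddCommGroup C] [Module R C]
    (f : A →ₗ[R] B) (g : B →ₗ[R] C) (hfg : Function.Exact f g)
    (hg : LinearMap.range g ≤ maximalIdeal R • (⊤ : Submodule R C))
    (hN : Module.length R (LinearMap.ker f) ≠ ⊤) :
    Module.finrank R B ≤ Module.finrank R A := by
  -- Compute the length of `P = f⁻¹(0 :_B x)` twice: `f` maps it onto `(0 :_B x)` with kernel `ker
  -- f`, while `x` maps it into `ker f` with kernel inside `(0 :_A x)`.
  let P : Submodule R A := (torsionBy R B x).comap f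
  let φ : P →ₗ[R] torsionBy R B x := f.restrict fun _ h => h
  have hφ : Function.Surjective φ := by
    rintro ⟨b, hb⟩
    -- Minimality of `g` puts the `x`-torsion of `B` inside `ker g = im f`.
    obtain ⟨a, ha⟩ := (hfg b).mp (map_eq_zero_of_minimal hann g hg ((mem_torsionBy_iff x b).mp hb))
    exact ⟨⟨a, by change f a ∈ torsionBy R B x; rwa [ha]⟩, Subtype.ext ha⟩
  let ψ : P →ₗ[R] LinearMap.ker f :=
    ((LinearMap.lsmul R A x).comp P.subtype).codRestrict _ fun p => by
      have : x • f p = 0 := (mem_torsionBy_iff x _).mp p.2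
      simpa using this
  let ι : LinearMap.ker f →ₗ[R] P := Submodule.inclusion fun a ha => by
    change f a ∈ torsionBy R B x
    rw [LinearMap.mem_ker.mp ha]
    exact zero_mem _
  let j : LinearMap.ker ψ →ₗ[R] torsionBy R A x :=
    (P.subtype.comp (LinearMap.ker ψ).subtype).codRestrict _ fun p => by
      rw [mem_torsionBy_iff]
      exact congrArg Subtype.val (LinearMap.mem_ker.mp p.2)
  have h₁ : Module.length R P =
      Module.length R (LinearMap.ker f) + Module.length R (torsionBy R B x) := by
    refine Module.length_eq_add_of_exact ι φ (Submodule.inclusion_injective _) hφ fun p => ?_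
    constructor
    · intro hp
      exact ⟨⟨p, congrArg Subtype.val hp⟩, rfl⟩
    · rintro ⟨a, rfl⟩
      exact Subtype.ext a.2
  have h₂ : Module.length R P =
      Module.length R (LinearMap.ker ψ) + Module.length R (LinearMap.range ψ) :=
    Module.length_eq_add_of_exact (LinearMap.ker ψ).subtype ψ.rangeRestrict
      (Submodule.subtype_injective _) ψ.surjective_rangeRestrict
      (by rw [LinearMap.exact_iff]; simp)
  have h₃ : Module.length R (LinearMap.ker ψ) ≤ Module.length R (torsionBy R A x) :=
    Module.length_le_of_injective j fun p q h => by
      have hpq : (j p : A) = j q := by rw [h]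
      exact Subtype.ext (Subtype.ext hpq)
  have h₄ : Module.length R (LinearMap.range ψ) ≤ Module.length R (LinearMap.ker f) :=
    Module.length_le_of_injective (LinearMap.range ψ).subtype (Submodule.subtype_injective _)
  have h₅ : Module.length R (torsionBy R B x) ≤ Module.length R (torsionBy R A x) := by
    rw [← (ENat.addLECancellable_of_ne_top hN).add_le_add_iff_left, ← h₁, h₂, add_comm]
    exact add_le_add h₄ h₃
  rw [length_torsionBy_of_free (A := B), length_torsionBy_of_free (A := A)] at h₅
  have htop : Module.length R (torsionBy R R x) ≠ ⊤ :=
    length_ne_top_of_pow_smul_eq_zero hann 1 _ fun a ha => by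
      simpa using (mem_torsionBy_iff x a).mp ha
  have hpos : Module.length R (torsionBy R R x) ≠ 0 := by
    rw [Ne, Module.length_eq_zero_iff, Submodule.subsingleton_iff_eq_bot]
    exact hsoc
  lift Module.length R (torsionBy R R x) to ℕ using htop with s
  have h₆ : Module.finrank R B * s ≤ Module.finrank R A * s := by exact_mod_cast h₅
  exact Nat.le_of_mul_le_mul_right h₆ (Nat.pos_of_ne_zero (by exact_mod_cast hpos))

/-! ### Inverting `x` in dimension one. -/

/-- Over a one-dimensional local ring, inverting an element of the maximal ideal gives an
Artinian ring. -/
theorem isArtinianRing_localizationAway [IsNoetherianRing R] (hdim : ringKrullDim R = 1)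
    (hx : x ∈ maximalIdeal R) :
    IsArtinianRing (Localization.Away x) := by
  have : IsNoetherianRing (Localization.Away x) :=
    IsLocalization.isNoetherianRing (Submonoid.powers x) _ inferInstance
  rw [isArtinianRing_iff_krullDimLE_zero]
  have h1 : Ring.KrullDimLE 1 R := by
    rw [Ring.krullDimLE_iff, hdim]
    rfl
  rw [Ring.krullDimLE_one_iff] at h1
  refine Ring.KrullDimLE.mk₀ fun I hI => ?_
  obtain ⟨J, hJ, hIJ⟩ := Ideal.exists_le_maximal I hI.ne_top
  have hJp := hJ.isPrime
  set c := algebraMap R (Localization.Away x)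
  have hxJ : x ∉ J.comap c := fun h => hJp.ne_top <|
    Ideal.eq_top_of_isUnit_mem _ h (IsLocalization.Away.algebraMap_isUnit x)
  -- In dimension at most one a prime is minimal or maximal, and this one misses `x`.
  have hmin : J.comap c ∈ minimalPrimes R := by
    refine (h1 _ inferInstance).resolve_right fun hmax => hxJ ?_
    rwa [IsLocalRing.eq_maximalIdeal hmax]
  have hle : J.comap c ≤ I.comap c :=
    hmin.2 ⟨inferInstance, bot_le⟩ (Ideal.comap_mono hIJ)
  have : J ≤ I := by
    rw [← IsLocalization.map_under (Submonoid.powers x) _ J,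
      ← IsLocalization.map_under (Submonoid.powers x) _ I]
    exact Ideal.map_mono hle
  rwa [le_antisymm hIJ this]

/-- Over a one-dimensional local ring, a map of free modules whose kernel is `x`-power torsion and
whose source has at least the rank of the target has `x`-power torsion cokernel. -/
theorem exists_pow_smul_mem_range [IsNoetherianRing R] (hdim : ringKrullDim R = 1)
    (hx : x ∈ maximalIdeal R)
    {A B : Type*} [AddCommGroup A] [Module R A] [Module.Free R A] [Module.Finite R A]
    [AddCommGroup B] [Module R B] [Module.Free R B] [Module.Finite R B]
    (f : A →ₗ[R] B) (hrank : Module.finrank R B ≤ Module.finrank R A)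
    (hker : ∀ a, f a = 0 → ∃ n : ℕ, x ^ n • a = 0) (b : B) :
    ∃ n : ℕ, x ^ n • b ∈ LinearMap.range f := by
  have hcard : Fintype.card (Module.Free.ChooseBasisIndex R B) ≤
      Fintype.card (Module.Free.ChooseBasisIndex R A) := by
    rwa [← Module.finrank_eq_card_chooseBasisIndex, ← Module.finrank_eq_card_chooseBasisIndex]
  obtain ⟨e⟩ := Function.Embedding.nonempty_of_card_le hcard
  let bA := Module.Free.chooseBasis R A
  let bB := Module.Free.chooseBasis R B
  -- Embedding `B` in `A` turns `f` into an endomorphism, and an injective endomorphism of an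
  -- Artinian module is surjective. Injectivity of `ι` later removes it from the conclusion.
  let ι : B →ₗ[R] A := bB.constr R (bA ∘ e)
  have hι : Function.Injective ι := by
    exact bB.injective_constr_of_linearIndependent (bA.linearIndependent.comp e e.injective)
  let S := Submonoid.powers x
  let l := LocalizedModule.mkLinearMap S A
  have : IsArtinianRing (Localization S) := isArtinianRing_localizationAway hdim hx
  have : Module.Finite (Localization S) (LocalizedModule S A) :=
    Module.Finite.of_isLocalizedModule S l
  let φ : A →ₗ[R] A := ι ∘ₗ f
  let L := IsLocalizedModule.mapExtendScalars S l l (Localization S) φ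
  have hLl : ∀ a, L (l a) = l (φ a) := fun a => IsLocalizedModule.map_apply S l l φ a
  have hLs : ∀ (s : S) z, L (s • z) = s • L z := fun s z => map_smul (L.restrictScalars R) (s : R) z
  have hinj : Function.Injective L := by
    rw [injective_iff_map_eq_zero]
    intro z hz
    obtain ⟨⟨a, s⟩, hs : s • z = l a⟩ := IsLocalizedModule.surj S l z
    have h0 : l (φ a) = 0 := by rw [← hLl, ← hs, hLs, hz, smul_zero]
    obtain ⟨c, hc⟩ := (IsLocalizedModule.eq_zero_iff S l).mp h0
    have hfa : f (c • a) = 0 := hι (by rw [map_zero, ← hc]; exact map_smul φ (c : R) a)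
    obtain ⟨n, hn⟩ := hker _ hfa
    have hla : l a = 0 := (IsLocalizedModule.eq_zero_iff S l).mpr
      ⟨⟨x ^ n, n, rfl⟩ * c, by rw [mul_smul]; exact hn⟩
    exact IsLocalizedModule.smul_injective l s (by simp only [hs, hla, smul_zero])
  obtain ⟨z, hz⟩ := IsArtinian.surjective_of_injective_endomorphism L hinj (l (ι b))
  obtain ⟨⟨a, s⟩, hs : s • z = l a⟩ := IsLocalizedModule.surj S l z
  have h0 : l (φ a) = l (s • ι b) := by
    rw [← hLl, ← hs, hLs, hz]
    exact (map_smul l (s : R) (ι b)).symm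
  obtain ⟨c, hc⟩ := IsLocalizedModule.exists_of_eq (S := S) h0
  obtain ⟨n, hn⟩ := (c * s).2
  refine ⟨n, (c : R) • a, hι ?_⟩
  have hn' : x ^ n = (c : R) * s := hn
  rw [hn', map_smul, map_smul, map_smul, mul_smul]
  exact hc

/-- `x` is not nilpotent over a ring of dimension one. -/
theorem not_isNilpotent_of_ringKrullDim_eq_one
    (hann : (⊥ : Ideal R).colon {x} = (⊥ : Ideal R).colon (maximalIdeal R : Set R))
    (hdim : ringKrullDim R = 1) : ¬ IsNilpotent x := by
  rintro ⟨n, hn⟩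
  -- By `hann`, each factor `x` can be traded for any `t ∈ 𝔪`, so nilpotence of `x` spreads to all
  -- of `𝔪`.
  have key : ∀ n : ℕ, ∀ s : R, x ^ n * s = 0 → ∀ t ∈ maximalIdeal R, t ^ n * s = 0 := by
    intro n
    induction n with
    | zero => intro s h _ _; simpa using h
    | succ n ih =>
      intro s h t ht
      have := smul_eq_zero_of_mem_torsionBy hann (a := x ^ n * s)
        (by rw [smul_eq_mul, ← h]; ring) ht
      rw [smul_eq_mul] at this
      have := ih (t * s) (by rw [← this]; ring) t ht
      rw [← this]
      ring
  have hnil : ∀ t ∈ maximalIdeal R, IsNilpotent t := fun t ht =>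
    ⟨n, by simpa using key n 1 (by simpa using hn) t ht⟩
  have h0 : Ring.KrullDimLE 0 R := by
    refine Ring.KrullDimLE.mk₀ fun I hI => ?_
    have : I = maximalIdeal R := le_antisymm (IsLocalRing.le_maximalIdeal hI.ne_top)
      fun t ht => by
        obtain ⟨k, hk⟩ := hnil t ht
        exact hI.mem_of_pow_mem k (hk ▸ I.zero_mem)
    rw [this]
    infer_instance
  rw [Ring.krullDimLE_iff, hdim] at h0
  exact absurd h0 (by decide)

end Torsion

/-! ### Descent along the resolution. -/

namespace MinimalFreeResolution

variable {R : Type u} [CommRing R] [IsLocalRing R] [IsNoetherianRing R]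
  {M : Type v} [AddCommGroup M] [Module R M] (F : MinimalFreeResolution.{u, v, w} R M)

/-- If `Syz_{n+3}` is `x`-power torsion then so is `Syz_{n+1}`, provided the socle is nonzero. -/
theorem syzygySucc_isTorsion_of_add_two (hdim : ringKrullDim R = 1)
    {x : R} (hx : x ∈ maximalIdeal R)
    (hann : (⊥ : Ideal R).colon {x} = (⊥ : Ideal R).colon (maximalIdeal R : Set R))
    (hsoc : torsionBy R R x ≠ ⊥) (n : ℕ)
    (h : ∀ a ∈ F.syzygySucc (n + 2), ∃ k : ℕ, x ^ k • a = 0) :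
    ∀ a ∈ F.syzygySucc n, ∃ k : ℕ, x ^ k • a = 0 := by
  have hker : LinearMap.ker (F.d (n + 1)) = F.syzygySucc (n + 2) :=
    LinearMap.exact_iff.mp (F.exact_succ (n + 1))
  have hlen : Module.length R (LinearMap.ker (F.d (n + 1))) ≠ ⊤ := by
    rw [hker]
    obtain ⟨k, hk⟩ := exists_forall_pow_smul_eq_zero (N := F.syzygySucc (n + 2)) (x := x)
      fun a => (h a a.2).imp fun k hk => Subtype.ext hk
    exact length_ne_top_of_pow_smul_eq_zero hann k _ fun a ha => congrArg Subtype.val (hk ⟨a, ha⟩)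
  have hrank := finrank_le_of_length_ker_ne_top hann hsoc _ _ (F.exact_succ n)
    (F.minimal n) hlen
  rintro _ ⟨b, rfl⟩
  obtain ⟨k, a, ha⟩ := exists_pow_smul_mem_range hdim hx (F.d (n + 1)) hrank
    (fun a ha => h a (hker ▸ ha)) b
  exact ⟨k, by rw [← map_smul, ← ha]; exact (F.exact_succ n).apply_apply_eq_zero a⟩

/-- If the first module of a minimal free resolution vanishes then all of them do. -/
theorem subsingleton_of_subsingleton_zero (h : Subsingleton (F.G 0)) (n : ℕ) :
    Subsingleton (F.G n) := by
  induction n with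
  | zero => exact h
  | succ n ih =>
    have htop : (⊤ : Submodule R (F.G (n + 1))) = ⊥ := by
      refine Submodule.eq_bot_of_le_smul_of_le_jacobson_bot (maximalIdeal R) _
        (IsNoetherian.noetherian _) (fun a _ => F.minimal (n + 1) ?_) (maximalIdeal_le_jacobson _)
      exact (F.exact_succ n a).mp (Subsingleton.elim _ _)
    exact (Submodule.subsingleton_iff R).mp (subsingleton_of_bot_eq_top htop.symm)

end MinimalFreeResolution

theorem mainTheorem10 (R : Type u) [CommRing R] [IsLocalRing R] [IsNoetherianRing R]
    (hdim : ringKrullDim R = 1)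
    (x : R) (hx : x ∈ IsLocalRing.maximalIdeal R)
    (hann : (⊥ : Ideal R).colon {x} = (⊥ : Ideal R).colon (IsLocalRing.maximalIdeal R : Set R))
    (M : Type v) [AddCommGroup M] [Module R M] (hM : IsFiniteLength R M)
    (F : MinimalFreeResolution.{u, v, w} R M)
    (i : ℕ) (hi : 2 ≤ i) (heven : Even i) (hne : F.syzygySucc i ≠ ⊥) :
    Module.length R (F.syzygySucc i) = ⊤ := by
  by_contra hfin
  have htors : ∀ a ∈ F.syzygySucc i, ∃ k : ℕ, x ^ k • a = 0 := by
    obtain ⟨k, hk⟩ := exists_pow_smul_eq_zero_of_isFiniteLength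
      (Module.length_ne_top_iff.mp hfin) hx
    exact fun a ha => ⟨k, congrArg Subtype.val (hk ⟨a, ha⟩)⟩
  -- Otherwise `x` acts injectively on the free module `G i`, which then has no nonzero `x`-power
  -- torsion.
  have hsoc : torsionBy R R x ≠ ⊥ := by
    intro hbot
    obtain ⟨a, ha, ha0⟩ := (Submodule.ne_bot_iff _).mp hne
    obtain ⟨k, hk⟩ := htors a ha
    have hlen : Module.length R (torsionBy R (F.G i) x) = 0 := by
      rw [length_torsionBy_of_free, hbot, Module.length_bot, mul_zero]
    have hinj : ∀ b : F.G i, x • b = 0 → b = 0 := fun b hb => by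
      rw [Module.length_eq_zero_iff, Submodule.subsingleton_iff_eq_bot] at hlen
      exact (Submodule.mem_bot R).mp (hlen ▸ (mem_torsionBy_iff x b).mpr hb)
    refine ha0 ?_
    clear ha ha0
    induction k with
    | zero => simpa using hk
    | succ k ih => exact ih (hinj _ (by rwa [pow_succ', mul_smul] at hk))
  have hzero : ∀ a ∈ F.syzygySucc 0, ∃ k : ℕ, x ^ k • a = 0 := by
    -- Evenness makes the descent by two land exactly on index `0`.
    obtain ⟨m, rfl⟩ := heven.two_dvd
    clear hi heven hne hfin
    induction m with
    | zero => exact htors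
    | succ m ih => exact ih (F.syzygySucc_isTorsion_of_add_two hdim hx hann hsoc _ htors)
  obtain ⟨n, hn⟩ := exists_pow_smul_eq_zero_of_isFiniteLength hM hx
  have hG : ∀ a : F.G 0, ∃ k : ℕ, x ^ k • a = 0 := fun a => by
    -- Since `x ^ n` kills `M`, it carries `G 0` into `ker ε = Syz_1`.
    obtain ⟨k, hk⟩ := hzero (x ^ n • a) ((F.exact_zero _).mp (by rw [map_smul, hn]))
    exact ⟨k + n, by rw [pow_add, mul_smul, hk]⟩
  have hsub : Subsingleton (F.G 0) := by
    by_contra hnt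
    rw [not_subsingleton_iff_nontrivial] at hnt
    obtain ⟨k, hk⟩ := exists_forall_pow_smul_eq_zero hG
    exact not_isNilpotent_of_ringKrullDim_eq_one hann hdim
      -- A nonzero free module is faithful, so `x ^ k = 0`.
      ⟨k, FaithfulSMul.eq_of_smul_eq_smul (α := F.G 0) fun a => by rw [hk, zero_smul]⟩
  have := F.subsingleton_of_subsingleton_zero hsub i
  exact hne (Subsingleton.elim _ _)
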